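/- Setting. Let $M>0$, $\mathcal X=[-M,M]^d$, and let $K:\mathcal X\times\mathcal X\to\mathbb R$ be a Mercer kernel (continuous, symmetric, positive semidefinite) with reproducing kernel Hilbert space $(\mathcal H_K,\|\cdot\|_K)$ and $K_x:=K(x,\cdot)$. Let $\rho$ be a probability distribution on $\mathcal X\times[-M,M]$ with marginal $\rho_X$ on $\mathcal X$ and regression function $f_\rho(x)=\int y\,d\rho(y|x)$; $\|\cdot\|_\rho$ is the norm of $L^2_{\rho_X}$. Let $L_Kf=\int_{\mathcal X}K_xf(x)\,d\rho_X(x)$, regarded as a compact positive operator on $L^2_{\rho_X}$ or on $\mathcal H_K$; its real powers are defined by the spectral theorem. Let $D=\{(x_t,y_t)\}_{t=1}^n\subset\mathcal X\times[-M,M]$ be arbitrary (deterministic) data and let $D_m=\{(\tilde x_i,\tilde y_i)\}_{i=1}^m$ be a sub-sample of $m\ge 1$ consecutive points of $D$. Put $\mathcal H_{D_m}=\mathrm{span}\{K_{\tilde x_1},\dots,K_{\tilde x_m}\}$, let $\lambda>0$, and let $$f_{D,D_m,\lambda}=\arg\min_{f\in\mathcal H_{D_m}}\frac1n\sum_{t=1}^n(f(x_t)-y_t)^2+\lambda\|f\|_K^2$$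 be the Nyström regularization estimator. On $\mathcal H_K$ let $L_{K,D}f=\frac1n\sum_{t=1}^nf(x_t)K_{x_t}$ and $S_D^Ty_D=\frac1n\sum_{t=1}^ny_tK_{x_t}$, define $L_{K,D_m}$ in the same way from the $m$ points of $D_m$, and set, with operator norms on $\mathcal H_K$, $$\mathcal Q_{D,\lambda}=\|(L_K+\lambda I)(L_{K,D}+\lambda I)^{-1}\|,\quad \mathcal Q^*_{D,\lambda}=\|(L_K+\lambda I)^{-1}(L_{K,D}+\lambda I)\|,\quad \mathcal Q_{D_m,\lambda}=\|(L_K+\lambda I)(L_{K,D_m}+\lambda I)^{-1}\|,$$ $$\mathcal P_{D,\lambda}=\|(L_K+\lambda I)^{-1/2}(L_{K,D}f_\rho-S_D^Ty_D)\|_K .$$ Proposition. Suppose that $f_\rho=L_K^rh_\rho$ in $L^2_{\rho_X}$ for some $h_\rho\in L^2_{\rho_X}$ and some $1/2\le r\le1$. Then $f_\rho$ has a unique representative in $\mathcal H_K$ (equal to $f_\rho$ $\rho_X$-almost everywhere) that is orthogonal in $\mathcal H_K$ to all functions of $\mathcal H_K$ vanishing $\rho_X$-almost everywhere (if $\rho_X$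 has full support, the orthogonality is automatic). With $\mathcal P_{D,\lambda}$ formed with this representative, $$\|f_{D,D_m,\lambda}-f_\rho\|_\rho\le \mathcal Q_{D,\lambda}\mathcal P_{D,\lambda}+\lambda^r\mathcal Q_{D,\lambda}^r\|h_\rho\|_\rho+\bigl(\mathcal Q_{D,\lambda}^{1/2}(\mathcal Q^*_{D,\lambda})^{1/2}+1\bigr)\lambda^r\mathcal Q_{D_m,\lambda}^r\|h_\rho\|_\rho .$$ -/

import Mathlib

open MeasureTheory
open scoped RealInnerProductSpace

noncomputable section

/-! ### Mercer kernels and their reproducing kernel Hilbert spaces -/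

/-- A Mercer kernel: continuous, symmetric and positive semidefinite. -/
structure IsMercerKernel {X : Type*} [TopologicalSpace X] (K : X → X → ℝ) : Prop where
  continuous : Continuous fun p : X × X => K p.1 p.2
  symm : ∀ x x', K x x' = K x' x
  nonneg : ∀ (k : ℕ) (x : Fin k → X) (c : Fin k → ℝ),
    0 ≤ ∑ i, ∑ j, c i * c j * K (x i) (x j)

section RKHSBasics

variable {X : Type*} {H : Type*} [NormedAddCommGroup H] [InnerProductSpace ℝ H]
  [RKHS ℝ H X ℝ]

/-- Point evaluation `f ↦ f x` on the space `H`. -/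
def evalAt (H : Type*) [NormedAddCommGroup H] [InnerProductSpace ℝ H] [RKHS ℝ H X ℝ]
    (x : X) : H →L[ℝ] ℝ :=
  (ContinuousLinearMap.proj (R := ℝ) (φ := fun _ : X => ℝ) x).comp
    (RKHS.coeCLM ℝ : H →L[ℝ] X → ℝ)

variable [CompleteSpace H]

/-- The kernel section `K_x = K(x, ·)` as an element of `H`. -/
def kerSec (H : Type*) [NormedAddCommGroup H] [InnerProductSpace ℝ H] [RKHS ℝ H X ℝ]
    [CompleteSpace H] (x : X) : H :=
  RKHS.kerFun H x (1 : ℝ)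

/-- `H` (a Hilbert space of functions on `X` with continuous evaluations) is the reproducing kernel
Hilbert space of the Mercer kernel `K`. -/
structure IsRKHSOf [TopologicalSpace X] (K : X → X → ℝ) (H : Type*) [NormedAddCommGroup H]
    [InnerProductSpace ℝ H] [RKHS ℝ H X ℝ] [CompleteSpace H] : Prop where
  mercer : IsMercerKernel K
  kerSec_apply : ∀ x x', kerSec H x x' = K x x'

theorem inner_kerSec (x : X) (f : H) : ⟪kerSec H x, f⟫ = f x := by
  simp [kerSec]

theorem norm_apply_le_of_kerSec (C : ℝ) (hC : ∀ x, ‖kerSec H x‖ ≤ C) (f : H) (x : X) :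
    ‖f x‖ ≤ C * ‖f‖ := by
  rw [← inner_kerSec]
  exact (norm_inner_le_norm _ _).trans (mul_le_mul_of_nonneg_right (hC x) (norm_nonneg _))

theorem IsRKHSOf.continuous_kerSec [TopologicalSpace X] {K : X → X → ℝ} (hH : IsRKHSOf K H) :
    Continuous (kerSec H : X → H) := by
  have hK := hH.mercer.continuous
  have key : ∀ x y : X, ‖kerSec H x - kerSec H y‖ ^ 2 = K x x - 2 * K x y + K y y := by
    intro x y
    rw [@norm_sub_sq_real, ← real_inner_self_eq_norm_sq, ← real_inner_self_eq_norm_sq,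
      inner_kerSec, inner_kerSec, inner_kerSec, hH.kerSec_apply, hH.kerSec_apply,
      hH.kerSec_apply, hH.mercer.symm y x]
  rw [continuous_iff_continuousAt]
  intro y
  rw [ContinuousAt, tendsto_iff_norm_sub_tendsto_zero]
  have h1 : Filter.Tendsto (fun x => Real.sqrt (K x x - 2 * K x y + K y y)) (nhds y) (nhds 0) := by
    have hc : Continuous fun x => Real.sqrt (K x x - 2 * K x y + K y y) := by
      have a : Continuous fun x => K x x := hK.comp (continuous_id.prodMk continuous_id)
      have b : Continuous fun x => K x y := hK.comp (continuous_id.prodMk continuous_const)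
      fun_prop
    have := hc.tendsto y
    have h0 : Real.sqrt (K y y - 2 * K y y + K y y) = 0 := by
      rw [show K y y - 2 * K y y + K y y = 0 by ring, Real.sqrt_zero]
    rwa [h0] at this
  refine h1.congr fun x => ?_
  rw [← key, Real.sqrt_sq (norm_nonneg _)]

theorem IsRKHSOf.continuous_coe [TopologicalSpace X] {K : X → X → ℝ} (hH : IsRKHSOf K H) (f : H) :
    Continuous (f : X → ℝ) := by
  have h : (f : X → ℝ) = fun x => ⟪kerSec H x, f⟫ := by
    funext x
    rw [inner_kerSec]
  rw [h]
  exact hH.continuous_kerSec.inner continuous_const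

theorem IsRKHSOf.exists_bound [TopologicalSpace X] [CompactSpace X] {K : X → X → ℝ}
    (hH : IsRKHSOf K H) : ∃ C : ℝ, 0 ≤ C ∧ ∀ x, ‖kerSec H x‖ ≤ C := by
  obtain ⟨C, hC⟩ := (isCompact_range hH.continuous_kerSec).isBounded.exists_norm_le
  exact ⟨max C 0, le_max_right _ _, fun x =>
    (hC _ (Set.mem_range_self x)).trans (le_max_left _ _)⟩

end RKHSBasics

/-! ### Powers of an operator -/

/-- `spectralPow T s v = T^s v`, by the spectral calculus `T^s = ∑_μ μ^s P_μ` over the eigenvalues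
`μ` of `T`, where `P_μ` is the orthogonal projection onto the eigenspace `ker (T - μ I)`
(which is `0` unless `μ` is an eigenvalue). It is used for nonnegative self-adjoint `T`
whose eigenvectors span a dense subspace, such as `L` and `L + λ I` with `L` compact. -/
def spectralPow {E : Type*} [NormedAddCommGroup E] [InnerProductSpace ℝ E] [CompleteSpace E]
    (T : E →L[ℝ] E) (s : ℝ) (v : E) : E :=
  ∑' μ : ℝ, μ ^ s • (T - μ • ContinuousLinearMap.id ℝ E).ker.starProjection v

/-! ### The integral operator -/

section IntegralOperator

variable {X : Type*} [TopologicalSpace X] [CompactSpace X] [SecondCountableTopology X]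
  [MeasurableSpace X] [OpensMeasurableSpace X]
  {H : Type*} [NormedAddCommGroup H] [InnerProductSpace ℝ H] [RKHS ℝ H X ℝ] [CompleteSpace H]
  {K : X → X → ℝ}

theorem IsRKHSOf.memLp_coe (hH : IsRKHSOf K H) (ν : Measure X) [IsFiniteMeasure ν] (f : H) :
    MemLp (f : X → ℝ) 2 ν := by
  obtain ⟨C, -, hC⟩ := hH.exists_bound
  exact MemLp.of_bound (hH.continuous_coe f).aestronglyMeasurable (C * ‖f‖)
    (Filter.Eventually.of_forall (norm_apply_le_of_kerSec C hC f))

theorem IsRKHSOf.memLp_kerSec (hH : IsRKHSOf K H) (ν : Measure X) [IsFiniteMeasure ν] :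
    MemLp (kerSec H : X → H) 2 ν := by
  obtain ⟨C, -, hC⟩ := hH.exists_bound
  exact MemLp.of_bound hH.continuous_kerSec.aestronglyMeasurable C
    (Filter.Eventually.of_forall hC)

theorem IsRKHSOf.integrable_smul (hH : IsRKHSOf K H) (ν : Measure X) [IsFiniteMeasure ν]
    (g : Lp ℝ 2 ν) : Integrable (fun x => g x • kerSec H x) ν :=
  memLp_one_iff_integrable.mp
    ((hH.memLp_kerSec ν).smul (p := 2) (q := 2) (r := 1) (Lp.memLp g))

/-- The inclusion `H → L²(ν)`. -/
def IsRKHSOf.incl (hH : IsRKHSOf K H) (ν : Measure X) [IsFiniteMeasure ν] : H →L[ℝ] Lp ℝ 2 ν :=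
  LinearMap.mkContinuousOfExistsBound
    { toFun := fun f => (hH.memLp_coe ν f).toLp f
      map_add' := fun f g => by
        rw [← MemLp.toLp_add]
        exact MemLp.toLp_congr _ _ (by rw [RKHS.coe_add])
      map_smul' := fun c f => by
        rw [RingHom.id_apply, ← MemLp.toLp_const_smul]
        exact MemLp.toLp_congr _ _ (by rw [RKHS.coe_smul]) }
    (by
      obtain ⟨C, hC0, hC⟩ := hH.exists_bound
      refine ⟨((measureUnivNNReal ν : ℝ) ^ (2 : ENNReal).toReal⁻¹) * C, fun f => ?_⟩
      rw [mul_assoc]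
      refine Lp.norm_le_of_ae_bound (mul_nonneg hC0 (norm_nonneg f)) ?_
      filter_upwards [(hH.memLp_coe ν f).coeFn_toLp] with x hx
      have hx' : ((hH.memLp_coe ν f).toLp f : X → ℝ) x = f x := hx
      change ‖((hH.memLp_coe ν f).toLp f : X → ℝ) x‖ ≤ C * ‖f‖
      rw [hx']
      exact norm_apply_le_of_kerSec C hC f x)

/-- The integral `g ↦ ∫ g(x) K_x dν(x)`, as a map `L²(ν) → H`. -/
def IsRKHSOf.integralMap (hH : IsRKHSOf K H) (ν : Measure X) [IsFiniteMeasure ν] :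
    Lp ℝ 2 ν →L[ℝ] H :=
  LinearMap.mkContinuousOfExistsBound
    { toFun := fun g => ∫ x, g x • kerSec H x ∂ν
      map_add' := fun g g' => by
        rw [← integral_add (hH.integrable_smul ν g) (hH.integrable_smul ν g')]
        refine integral_congr_ae ?_
        filter_upwards [Lp.coeFn_add g g'] with x hx
        rw [hx, Pi.add_apply, add_smul]
      map_smul' := fun c g => by
        rw [RingHom.id_apply, ← integral_smul]
        refine integral_congr_ae ?_
        filter_upwards [Lp.coeFn_smul c g] with x hx
        rw [hx, Pi.smul_apply, smul_assoc] }
    (by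
      refine ⟨‖hH.incl ν‖, fun g => ?_⟩
      have h : ∀ f : H, ⟪f, ∫ x, g x • kerSec H x ∂ν⟫ = ⟪hH.incl ν f, g⟫ := by
        intro f
        rw [← integral_inner (hH.integrable_smul ν g) f, L2.inner_def]
        refine integral_congr_ae ?_
        filter_upwards [(hH.memLp_coe ν f).coeFn_toLp] with x hx
        have hx' : (hH.incl ν f : X → ℝ) x = f x := hx
        rw [hx', real_inner_smul_right, real_inner_comm, inner_kerSec]
        simp
      change ‖∫ x, g x • kerSec H x ∂ν‖ ≤ _
      by_cases h0 : ‖∫ x, g x • kerSec H x ∂ν‖ = 0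
      · rw [h0]
        positivity
      · have hpos : 0 < ‖∫ x, g x • kerSec H x ∂ν‖ := lt_of_le_of_ne (norm_nonneg _) (Ne.symm h0)
        refine le_of_mul_le_mul_left ?_ hpos
        rw [← real_inner_self_eq_norm_mul_norm, h]
        refine (real_inner_le_norm _ _).trans ?_
        refine (mul_le_mul_of_nonneg_right ((hH.incl ν).le_opNorm _) (norm_nonneg g)).trans
          (le_of_eq ?_)
        ring)

/-- The integral operator `L_K f = ∫ K_x f(x) dν(x)` on `H`. -/
def IsRKHSOf.LK (hH : IsRKHSOf K H) (ν : Measure X) [IsFiniteMeasure ν] : H →L[ℝ] H :=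
  (hH.integralMap ν).comp (hH.incl ν)

/-- The integral operator `L_K f = ∫ K_x f(x) dν(x)` on `L²(ν)`. -/
def IsRKHSOf.LKL2 (hH : IsRKHSOf K H) (ν : Measure X) [IsFiniteMeasure ν] :
    Lp ℝ 2 ν →L[ℝ] Lp ℝ 2 ν :=
  (hH.incl ν).comp (hH.integralMap ν)

end IntegralOperator

/-! ### The regression function -/

/-- The regression function `f_ρ(x) = ∫ y dρ(y|x)`, with `ρ(·|x)` the conditional distribution. -/
def regressionFunction {X : Type*} [MeasurableSpace X] (ρ : Measure (X × ℝ)) [IsFiniteMeasure ρ]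
    (x : X) : ℝ :=
  ∫ y, y ∂(ρ.condKernel x)

/-- `f ∈ H` is the canonical representative in `H` of the `ν`-almost everywhere class of `u`:
it equals `u` almost everywhere and is orthogonal to all elements of `H` that vanish almost
everywhere (equivalently, it has the least norm among all representatives in `H`).
If `ν` has full support, the second condition is void. -/
def IsRepresentative {X : Type*} [MeasurableSpace X] {H : Type*} [NormedAddCommGroup H]
    [InnerProductSpace ℝ H] [RKHS ℝ H X ℝ] (ν : Measure X) (u : X → ℝ) (f : H) : Prop :=
  (f : X → ℝ) =ᵐ[ν] u ∧ ∀ g : H, (g : X → ℝ) =ᵐ[ν] 0 → ⟪f, g⟫ = 0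

/-! ### Sampling operators and Nyström regularization -/

section Sampling

variable {X : Type*} (H : Type*) [NormedAddCommGroup H] [InnerProductSpace ℝ H]
  [RKHS ℝ H X ℝ]

/-- The sampling operator `S_D f = (f(x_1), …, f(x_n))`. -/
def samplingOp {n : ℕ} (D : Fin n → X × ℝ) : H →L[ℝ] (Fin n → ℝ) :=
  ContinuousLinearMap.pi fun i => evalAt H (D i).1

variable [CompleteSpace H]

/-- The scaled adjoint `S_Dᵀ c = (1/n) ∑ c_i K_{x_i}`. -/
def samplingAdj {n : ℕ} (D : Fin n → X × ℝ) : (Fin n → ℝ) →L[ℝ] H :=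
  (1 / (n : ℝ)) • ∑ i, (ContinuousLinearMap.proj (R := ℝ) (φ := fun _ : Fin n => ℝ) i).smulRight
    (kerSec H (D i).1)

/-- The empirical integral operator `L_{K,D} = S_Dᵀ S_D`. -/
def LKD {n : ℕ} (D : Fin n → X × ℝ) : H →L[ℝ] H :=
  (samplingAdj H D).comp (samplingOp H D)

/-- The outputs `y_D = (y_1, …, y_n)` of the sample. -/
def outputs {n : ℕ} (D : Fin n → X × ℝ) : Fin n → ℝ := fun i => (D i).2

/-- The consecutive sub-sample of size `m` of `D` that starts after the first `j` points. -/
def seqSubsample {n : ℕ} (D : Fin n → X × ℝ) (j m : ℕ) (h : j + m ≤ n) : Fin m → X × ℝ :=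
  fun i => D ⟨j + i, by omega⟩

/-- The space of linear combinations of the `K_{x̃_i}`, for a sub-sample `D'`. -/
def hypSpace {m : ℕ} (D' : Fin m → X × ℝ) : Submodule ℝ H :=
  Submodule.span ℝ (Set.range fun i => kerSec H (D' i).1)

variable {H}

/-- The regularized empirical risk `(1/n) ∑ (f(x_t) - y_t)² + lam ‖f‖²`. -/
def regRisk {n : ℕ} (D : Fin n → X × ℝ) (lam : ℝ) (f : H) : ℝ :=
  1 / (n : ℝ) * ∑ t, (f (D t).1 - (D t).2) ^ 2 + lam * ‖f‖ ^ 2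

/-- `f` is the Nyström regularization estimator: the minimizer of the regularized empirical risk
of `D` over the hypothesis space of the sub-sample `D'`. -/
def IsNystrom {n m : ℕ} (D : Fin n → X × ℝ) (D' : Fin m → X × ℝ) (lam : ℝ) (f : H) : Prop :=
  f ∈ hypSpace H D' ∧ ∀ g ∈ hypSpace H D', regRisk D lam f ≤ regRisk D lam g

end Sampling

/-! ### Operator products and differences -/

section Quantities

variable {X : Type*} [TopologicalSpace X] [CompactSpace X] [SecondCountableTopology X]
  [MeasurableSpace X] [OpensMeasurableSpace X]
  {H : Type*} [NormedAddCommGroup H] [InnerProductSpace ℝ H] [RKHS ℝ H X ℝ] [CompleteSpace H]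
  {K : X → X → ℝ}

/-- `Q_{D,lam} = ‖(L_K + lam I) (L_{K,D} + lam I)⁻¹‖`. -/
def IsRKHSOf.Q (hH : IsRKHSOf K H) (ν : Measure X) [IsFiniteMeasure ν] {n : ℕ}
    (D : Fin n → X × ℝ) (lam : ℝ) : ℝ :=
  ‖(hH.LK ν + lam • 1) * Ring.inverse (LKD H D + lam • 1)‖

/-- `Q*_{D,lam} = ‖(L_K + lam I)⁻¹ (L_{K,D} + lam I)‖`. -/
def IsRKHSOf.Qstar (hH : IsRKHSOf K H) (ν : Measure X) [IsFiniteMeasure ν] {n : ℕ}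
    (D : Fin n → X × ℝ) (lam : ℝ) : ℝ :=
  ‖Ring.inverse (hH.LK ν + lam • 1) * (LKD H D + lam • 1)‖

/-- `P_{D,lam} = ‖(L_K + lam I)^(-1/2) (L_{K,D} f - S_Dᵀ y_D)‖` (to be used with `f = f_ρ`). -/
def IsRKHSOf.P (hH : IsRKHSOf K H) (ν : Measure X) [IsFiniteMeasure ν] {n : ℕ}
    (D : Fin n → X × ℝ) (lam : ℝ) (f : H) : ℝ :=
  ‖spectralPow (hH.LK ν + lam • 1) (-1 / 2) (LKD H D f - samplingAdj H D (outputs D))‖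

end Quantities

/-- The input space `[-M, M]^d`. -/
abbrev InputSpace (d : ℕ) (M : ℝ) : Type :=
  Set.Icc (fun _ : Fin d => -M) (fun _ : Fin d => M)

end

/-! ### Quadratic forms of positive operators -/

section Forms

variable {E : Type*} [NormedAddCommGroup E] [InnerProductSpace ℝ E]

/-! Let J be the inclusion of H into L², A = L_K + λ, B = L_{K,D} + λ, C = L_{K,D_m} + λ, V the
hypothesis space and g the representative of f_ρ. The products of operators enter only through
inequalities of quadratic forms: by Löwner–Heinz, A ≤ Q_D B, B ≤ Q*_D A and A ≤ Q_{D_m} C.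

The source condition also enters in a weak form. Since J* is the integral map, L_K is JJ* on L² and
J*J on H, and f_ρ = (JJ*)^r h yields ⟪g, w⟫ ≤ ‖h‖ ‖Jw‖^(2r-1) ‖w‖^(2-2r) for all w
(`exists_preimage_spectralPow`). This interpolation replaces norm estimates of products of
fractional powers.

Split f - g = e - v with p the projection of g onto V, e = f - p in V and v = g - p orthogonal to V.
As v vanishes at the sub-sample points, its C-form is λ‖v‖²; with ‖v‖² = ⟪g, v⟫ and the source
inequality this bounds the A-norm of v by λ^r Q_{D_m}^r ‖h‖. The Euler equation tested with e gives
⟪Be, e⟫ = ⟪Bv, e⟫ - λ⟪g, e⟫ + ⟪q, e⟫, where q = S_Dᵀ y_D - L_{K,D} g is the noise. Each term is a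
constant times the B-norm of e; dividing by that norm and passing to the A-norm costs a factor
Q_D^(1/2) and gives the bound (`norm_map_sub_le_of_galerkin`). -/

/-- Cauchy–Schwarz for a semidefinite form: the form at x + t y is a nonnegative quadratic in t. -/
theorem inner_map_sq_le {T : E →L[ℝ] E} (hs : ∀ x y, ⟪T x, y⟫ = ⟪x, T y⟫)
    (hp : ∀ x, 0 ≤ ⟪T x, x⟫) (x y : E) : ⟪T x, y⟫ ^ 2 ≤ ⟪T x, x⟫ * ⟪T y, y⟫ := by
  have h : ∀ t : ℝ, 0 ≤ ⟪T y, y⟫ * (t * t) + (2 * ⟪T x, y⟫) * t + ⟪T x, x⟫ := by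
    intro t
    have h1 := hp (x + t • y)
    have h2 : ⟪T y, x⟫ = ⟪T x, y⟫ := by rw [hs, real_inner_comm]
    simp only [map_add, map_smul, inner_add_left, inner_add_right, real_inner_smul_left,
      real_inner_smul_right, h2] at h1
    linarith
  have := discrim_le_zero h
  rw [discrim] at this
  linarith

theorem abs_inner_map_le {T : E →L[ℝ] E} (hs : ∀ x y, ⟪T x, y⟫ = ⟪x, T y⟫)
    (hp : ∀ x, 0 ≤ ⟪T x, x⟫) (x y : E) :
    |⟪T x, y⟫| ≤ √⟪T x, x⟫ * √⟪T y, y⟫ := by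
  rw [← Real.sqrt_mul (hp x)]
  exact Real.abs_le_sqrt (inner_map_sq_le hs hp x y)

/-- Cauchy–Schwarz with y = T x, that is, T² ≤ ‖T‖ T. -/
theorem norm_map_sq_le {T : E →L[ℝ] E} (hs : ∀ x y, ⟪T x, y⟫ = ⟪x, T y⟫)
    (hp : ∀ x, 0 ≤ ⟪T x, x⟫) (x : E) : ‖T x‖ ^ 2 ≤ ‖T‖ * ⟪T x, x⟫ := by
  have h1 := inner_map_sq_le hs hp x (T x)
  have h2 : ⟪T (T x), T x⟫ ≤ ‖T‖ * ‖T x‖ ^ 2 := by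
    refine (real_inner_le_norm _ _).trans ?_
    have := mul_le_mul_of_nonneg_right (T.le_opNorm (T x)) (norm_nonneg (T x))
    linarith
  rw [real_inner_self_eq_norm_sq] at h1
  rcases (sq_nonneg ‖T x‖).eq_or_lt with h0 | h0
  · rw [← h0]
    exact mul_nonneg (norm_nonneg _) (hp x)
  · refine le_of_mul_le_mul_right ?_ h0
    have := mul_le_mul_of_nonneg_left h2 (hp x)
    linarith

/-- The Löwner–Heinz inequality for the square root: `A² ≤ Q² B²` implies `A ≤ Q B`. -/
theorem inner_map_le_of_norm_map_le {A B : E →L[ℝ] E}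
    (hAs : ∀ x y, ⟪A x, y⟫ = ⟪x, A y⟫) (hBs : ∀ x y, ⟪B x, y⟫ = ⟪x, B y⟫)
    {c : ℝ} (hc : 0 < c) (hB : ∀ x, c * ‖x‖ ^ 2 ≤ ⟪B x, x⟫)
    {Q : ℝ} (h : ∀ x, ‖A x‖ ≤ Q * ‖B x‖) (x : E) : ⟪A x, x⟫ ≤ Q * ⟪B x, x⟫ := by
  have hup : ∀ (T : E →L[ℝ] E) (x : E), ⟪T x, x⟫ ≤ ‖T‖ * ‖x‖ ^ 2 := by
    intro T x
    refine (real_inner_le_norm _ _).trans ?_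
    have := mul_le_mul_of_nonneg_right (T.le_opNorm x) (norm_nonneg x)
    linarith
  have hB0 : ∀ x, 0 ≤ ⟪B x, x⟫ := fun x => (by positivity : 0 ≤ c * ‖x‖ ^ 2).trans (hB x)
  have hBn : ∀ x, c * ‖x‖ ≤ ‖B x‖ := by
    intro x
    rcases (norm_nonneg x).eq_or_lt with h0 | h0
    · rw [← h0, mul_zero]; exact norm_nonneg _
    · refine le_of_mul_le_mul_right ?_ h0
      have := (hB x).trans (real_inner_le_norm _ _)
      linarith
  -- Let t be the least number ≥ Q with A ≤ t B. If t > Q, then ‖(tB - A)x‖ ≥ (t - Q)‖Bx‖ makes the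
  -- nonnegative operator tB - A bounded below, hence coercive, so t could be lowered.
  let S : Set ℝ := {t | Q ≤ t ∧ ∀ x, ⟪A x, x⟫ ≤ t * ⟪B x, x⟫}
  have hSne : S.Nonempty := by
    refine ⟨max Q (‖A‖ / c), le_max_left _ _, fun x => (hup A x).trans ?_⟩
    calc ‖A‖ * ‖x‖ ^ 2 = ‖A‖ / c * (c * ‖x‖ ^ 2) := by field_simp
      _ ≤ ‖A‖ / c * ⟪B x, x⟫ := mul_le_mul_of_nonneg_left (hB x) (by positivity)
      _ ≤ _ := mul_le_mul_of_nonneg_right (le_max_right _ _) (hB0 x)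
  have hSb : BddBelow S := ⟨Q, fun t ht => ht.1⟩
  have hSc : IsClosed S := by
    have : S = Set.Ici Q ∩ ⋂ x, {t : ℝ | ⟪A x, x⟫ ≤ t * ⟪B x, x⟫} := by
      ext t; simp [S]
    rw [this]
    refine isClosed_Ici.inter (isClosed_iInter fun x => ?_)
    exact isClosed_le continuous_const (continuous_id.mul continuous_const)
  obtain ⟨hQt, ht⟩ := hSc.csInf_mem hSne hSb
  set t := sInf S with htdef
  rcases hQt.eq_or_lt with heq | hlt
  · rw [heq]; exact ht x
  exfalso
  let T : E →L[ℝ] E := t • B - A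
  have hTa : ∀ x, T x = t • B x - A x := fun x => rfl
  have hTs : ∀ x y, ⟪T x, y⟫ = ⟪x, T y⟫ := by
    intro x y
    rw [hTa, hTa, inner_sub_left, inner_sub_right, real_inner_smul_left, real_inner_smul_right,
      hAs, hBs]
  have hTf : ∀ x, ⟪T x, x⟫ = t * ⟪B x, x⟫ - ⟪A x, x⟫ := by
    intro x
    rw [hTa, inner_sub_left, real_inner_smul_left]
  have hTp : ∀ x, 0 ≤ ⟪T x, x⟫ := fun x => by rw [hTf]; linarith [ht x]
  have hlow : ∀ x, (t - Q) * c * ‖x‖ ≤ ‖T x‖ := by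
    intro x
    have h1 : ‖A x‖ ≤ t * ‖B x‖ - (t - Q) * ‖B x‖ := by linarith [h x]
    have h2 : t * ‖B x‖ ≤ ‖t • B x‖ := by
      rw [norm_smul]
      exact mul_le_mul_of_nonneg_right (le_abs_self t) (norm_nonneg _)
    have h3 := norm_sub_norm_le (t • B x) (A x)
    have h4 := mul_le_mul_of_nonneg_left (hBn x) (sub_nonneg.mpr hlt.le)
    rw [hTa]
    linarith
  set δ := (t - Q) * c with hδ
  have hδ0 : 0 < δ := mul_pos (sub_pos.mpr hlt) hc
  set k := (‖T‖ + 1) * (‖B‖ + 1) with hk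
  have hk0 : 0 < k := by positivity
  -- T² ≤ ‖T‖ T turns the lower bound on ‖Tx‖ into one on the form. The added ones in k only keep it
  -- positive.
  have hgain : ∀ x, δ ^ 2 / k * ⟪B x, x⟫ ≤ ⟪T x, x⟫ := by
    intro x
    have h1 : δ ^ 2 * ‖x‖ ^ 2 ≤ (‖T‖ + 1) * ⟪T x, x⟫ := by
      have a := norm_map_sq_le hTs hTp x
      have b : (δ * ‖x‖) ^ 2 ≤ ‖T x‖ ^ 2 := pow_le_pow_left₀ (by positivity) (hlow x) 2
      have := hTp x
      nlinarith
    have h2 : ⟪B x, x⟫ ≤ (‖B‖ + 1) * ‖x‖ ^ 2 := by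
      have := hup B x
      nlinarith [sq_nonneg ‖x‖]
    rw [div_mul_eq_mul_div, div_le_iff₀ hk0]
    calc δ ^ 2 * ⟪B x, x⟫ ≤ δ ^ 2 * ((‖B‖ + 1) * ‖x‖ ^ 2) := by gcongr
      _ = (‖B‖ + 1) * (δ ^ 2 * ‖x‖ ^ 2) := by ring
      _ ≤ (‖B‖ + 1) * ((‖T‖ + 1) * ⟪T x, x⟫) := by gcongr
      _ = _ := by rw [hk]; ring
  have hmem : max Q (t - δ ^ 2 / k) ∈ S := by
    refine ⟨le_max_left _ _, fun x => ?_⟩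
    have h1 := hgain x
    rw [hTf] at h1
    have h2 := mul_le_mul_of_nonneg_right (le_max_right Q (t - δ ^ 2 / k)) (hB0 x)
    linarith
  have h1 := csInf_le hSb hmem
  rw [← htdef] at h1
  have h2 : 0 < δ ^ 2 / k := by positivity
  have h3 : max Q (t - δ ^ 2 / k) < t := max_lt hlt (by linarith)
  linarith

variable [CompleteSpace E]

theorem isUnit_of_le_inner_map {B : E →L[ℝ] E} {c : ℝ} (hc : 0 < c)
    (hB : ∀ x, c * ‖x‖ ^ 2 ≤ ⟪B x, x⟫) : IsUnit B := by
  refine ContinuousLinearMap.isUnit_of_forall_le_norm_inner_map B (c := ⟨c, hc.le⟩) hc fun x => ?_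
  refine le_trans ?_ (le_abs_self _)
  have := hB x
  change ‖x‖ ^ 2 * c ≤ _
  linarith

theorem inner_map_le_norm_mul_inverse {A B : E →L[ℝ] E}
    (hAs : ∀ x y, ⟪A x, y⟫ = ⟪x, A y⟫) (hBs : ∀ x y, ⟪B x, y⟫ = ⟪x, B y⟫)
    {c : ℝ} (hc : 0 < c) (hB : ∀ x, c * ‖x‖ ^ 2 ≤ ⟪B x, x⟫) (x : E) :
    ⟪A x, x⟫ ≤ ‖A * Ring.inverse B‖ * ⟪B x, x⟫ := by
  refine inner_map_le_of_norm_map_le hAs hBs hc hB (fun y => ?_) x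
  have h1 : A = A * Ring.inverse B * B := by
    rw [mul_assoc, Ring.inverse_mul_cancel _ (isUnit_of_le_inner_map hc hB), mul_one]
  conv_lhs => rw [h1]
  exact (A * Ring.inverse B).le_opNorm (B y)

/-- The inverse now stands on the left: with N = A⁻¹B, taking adjoints in B = AN gives B = N*A, so
‖By‖ ≤ ‖N‖ ‖Ay‖. -/
theorem inner_map_le_norm_inverse_mul {A B : E →L[ℝ] E}
    (hAs : ∀ x y, ⟪A x, y⟫ = ⟪x, A y⟫) (hBs : ∀ x y, ⟪B x, y⟫ = ⟪x, B y⟫)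
    {c : ℝ} (hc : 0 < c) (hA : ∀ x, c * ‖x‖ ^ 2 ≤ ⟪A x, x⟫) (x : E) :
    ⟪B x, x⟫ ≤ ‖Ring.inverse A * B‖ * ⟪A x, x⟫ := by
  refine inner_map_le_of_norm_map_le hBs hAs hc hA (fun y => ?_) x
  set N := Ring.inverse A * B with hN
  have h1 : A * N = B := by
    rw [hN, ← mul_assoc, Ring.mul_inverse_cancel _ (isUnit_of_le_inner_map hc hA), one_mul]
  have h2 : B y = N.adjoint (A y) := by
    refine ext_inner_right ℝ fun z => ?_
    rw [ContinuousLinearMap.adjoint_inner_left, hAs, hBs, ← h1]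
    rfl
  rw [h2, ← ContinuousLinearMap.adjoint.norm_map N]
  exact N.adjoint.le_opNorm _

end Forms

/-! ### Orthogonal sums -/

section OrthogonalSums

variable {E : Type*} [NormedAddCommGroup E] [InnerProductSpace ℝ E] {ι : Type*}

theorem norm_sum_sq_of_pairwise_orthogonal {q : ι → E} (hq : ∀ i j, i ≠ j → ⟪q i, q j⟫ = 0)
    (s : Finset ι) : ‖∑ i ∈ s, q i‖ ^ 2 = ∑ i ∈ s, ‖q i‖ ^ 2 := by
  classical
  rw [← real_inner_self_eq_norm_sq, sum_inner]
  refine Finset.sum_congr rfl fun i hi => ?_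
  rw [inner_sum, Finset.sum_eq_single i (fun j _ hj => hq i j hj.symm) (fun h => absurd hi h),
    real_inner_self_eq_norm_sq]

/-- Bessel's inequality. -/
theorem sum_norm_sq_le_of_inner_eq {q : ι → E} (hq : ∀ i j, i ≠ j → ⟪q i, q j⟫ = 0)
    {w : E} (hw : ∀ i, ⟪w, q i⟫ = ‖q i‖ ^ 2) (s : Finset ι) :
    ∑ i ∈ s, ‖q i‖ ^ 2 ≤ ‖w‖ ^ 2 := by
  have h1 : 0 ≤ ‖w - ∑ i ∈ s, q i‖ ^ 2 := sq_nonneg _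
  rw [norm_sub_sq_real, norm_sum_sq_of_pairwise_orthogonal hq, inner_sum,
    Finset.sum_congr rfl fun i _ => hw i] at h1
  linarith

theorem summable_norm_sq_of_inner_eq {q : ι → E} (hq : ∀ i j, i ≠ j → ⟪q i, q j⟫ = 0)
    {w : E} (hw : ∀ i, ⟪w, q i⟫ = ‖q i‖ ^ 2) : Summable fun i => ‖q i‖ ^ 2 :=
  summable_of_sum_le (fun _ => sq_nonneg _) (sum_norm_sq_le_of_inner_eq hq hw)

/-- The lines spanned by the q i form an orthogonal family, for which summability is that of the
squared norms. -/
theorem summable_of_pairwise_orthogonal [CompleteSpace E] {q : ι → E}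
    (hq : ∀ i j, i ≠ j → ⟪q i, q j⟫ = 0) (hs : Summable fun i => ‖q i‖ ^ 2) : Summable q := by
  have hV : OrthogonalFamily ℝ (fun i => ℝ ∙ q i) fun i => (ℝ ∙ q i).subtypeₗᵢ := by
    rintro i j hij ⟨v, hv⟩ ⟨w, hw⟩
    obtain ⟨a, rfl⟩ := Submodule.mem_span_singleton.mp hv
    obtain ⟨b, rfl⟩ := Submodule.mem_span_singleton.mp hw
    change ⟪a • q i, b • q j⟫ = 0
    rw [real_inner_smul_left, real_inner_smul_right, hq i j hij, mul_zero, mul_zero]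
  exact (hV.summable_iff_norm_sq_summable
    fun i => ⟨q i, Submodule.mem_span_singleton_self (q i)⟩).mpr hs

end OrthogonalSums

/-! ### Hölder's inequality with weights -/

theorem sum_rpow_mul_rpow_le {ι : Type*} (s : Finset ι) {a b : ι → ℝ} (ha : ∀ i, 0 ≤ a i)
    (hb : ∀ i, 0 ≤ b i) {θ η : ℝ} (hθ : 0 ≤ θ) (hη : 0 ≤ η) (h : θ + η = 1) :
    ∑ i ∈ s, a i ^ θ * b i ^ η ≤ (∑ i ∈ s, a i) ^ θ * (∑ i ∈ s, b i) ^ η := by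
  -- The endpoint exponents, which occur for r = 1/2 and r = 1, have no finite Hölder conjugates.
  rcases hθ.eq_or_lt with rfl | hθ
  · obtain rfl : η = 1 := by linarith
    simp
  rcases hη.eq_or_lt with rfl | hη
  · obtain rfl : θ = 1 := by linarith
    simp
  have hpq : (θ⁻¹).HolderConjugate η⁻¹ := Real.HolderConjugate.inv_inv hθ hη h
  have := Real.inner_le_Lp_mul_Lq_of_nonneg s hpq (f := fun i => a i ^ θ) (g := fun i => b i ^ η)
    (fun i _ => Real.rpow_nonneg (ha i) _) (fun i _ => Real.rpow_nonneg (hb i) _)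
  simpa only [one_div, inv_inv, Real.rpow_rpow_inv (ha _) hθ.ne',
    Real.rpow_rpow_inv (hb _) hη.ne'] using this

/-! ### Eigenprojections -/

section Eigenprojections

variable {E : Type*} [NormedAddCommGroup E] [InnerProductSpace ℝ E]

theorem mem_ker_sub_smul_id {T : E →L[ℝ] E} {μ : ℝ} {v : E} :
    v ∈ (T - μ • ContinuousLinearMap.id ℝ E).ker ↔ T v = μ • v := by
  rw [LinearMap.mem_ker]
  exact sub_eq_zero

variable [CompleteSpace E]

/-- The orthogonal projection onto the eigenspace `ker (T - μ I)`. -/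
noncomputable abbrev eigenProj (T : E →L[ℝ] E) (μ : ℝ) : E →L[ℝ] E :=
  (T - μ • ContinuousLinearMap.id ℝ E).ker.starProjection

theorem map_eigenProj (T : E →L[ℝ] E) (μ : ℝ) (v : E) :
    T (eigenProj T μ v) = μ • eigenProj T μ v :=
  mem_ker_sub_smul_id.mp (Submodule.starProjection_apply_mem _ v)

theorem inner_eigenProj_eq (T : E →L[ℝ] E) (μ : ℝ) (v w : E) :
    ⟪eigenProj T μ v, eigenProj T μ w⟫ = ⟪v, eigenProj T μ w⟫ := by
  have := Submodule.starProjection_inner_eq_zero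
    (K := (T - μ • ContinuousLinearMap.id ℝ E).ker) v _
    (Submodule.starProjection_apply_mem _ w)
  rw [inner_sub_left, sub_eq_zero] at this
  exact this.symm

theorem inner_eigenProj_self (T : E →L[ℝ] E) (μ : ℝ) (v : E) :
    ⟪v, eigenProj T μ v⟫ = ‖eigenProj T μ v‖ ^ 2 := by
  rw [← inner_eigenProj_eq, real_inner_self_eq_norm_sq]

variable {T : E →L[ℝ] E} (hs : ∀ x y, ⟪T x, y⟫ = ⟪x, T y⟫)

include hs in
theorem inner_eigenProj_of_ne {μ ν : ℝ} (h : μ ≠ ν) (v w : E) :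
    ⟪eigenProj T μ v, eigenProj T ν w⟫ = 0 := by
  have := hs (eigenProj T μ v) (eigenProj T ν w)
  rw [map_eigenProj, map_eigenProj, real_inner_smul_left, real_inner_smul_right] at this
  have h2 : (μ - ν) * ⟪eigenProj T μ v, eigenProj T ν w⟫ = 0 := by linarith
  exact (mul_eq_zero.mp h2).resolve_left (sub_ne_zero.mpr h)

/-- Testing the lower bound on an eigenvector. In sums over all real μ it removes the terms where
the value of `μ ^ s` would be meaningless. -/
theorem eigenProj_eq_zero_or_le {c : ℝ} (hc : ∀ x, c * ‖x‖ ^ 2 ≤ ⟪T x, x⟫) (μ : ℝ) (v : E) :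
    eigenProj T μ v = 0 ∨ c ≤ μ := by
  rw [or_iff_not_imp_left]
  intro h
  have h1 := hc (eigenProj T μ v)
  rw [map_eigenProj, real_inner_smul_left, real_inner_self_eq_norm_sq] at h1
  exact le_of_mul_le_mul_right h1 (pow_pos (norm_pos_iff.mpr h) 2)

include hs in
theorem summable_norm_sq_eigenProj (v : E) : Summable fun μ : ℝ => ‖eigenProj T μ v‖ ^ 2 :=
  summable_norm_sq_of_inner_eq (w := v) (fun _ _ h => inner_eigenProj_of_ne hs h v v)
    fun μ => inner_eigenProj_self T μ v

include hs in
-- Bessel's inequality gives convergence to some S; v - S is orthogonal to every eigenspace, hence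
-- zero.
theorem hasSum_eigenProj (hd : (⨆ μ : ℝ, (T - μ • ContinuousLinearMap.id ℝ E).ker)ᗮ = ⊥) (v : E) :
    HasSum (fun μ : ℝ => eigenProj T μ v) v := by
  have hsum : Summable fun μ : ℝ => eigenProj T μ v :=
    summable_of_pairwise_orthogonal (fun _ _ h => inner_eigenProj_of_ne hs h v v)
      (summable_norm_sq_eigenProj hs v)
  obtain ⟨S, hS⟩ := hsum
  suffices v - S ∈ (⨆ μ : ℝ, (T - μ • ContinuousLinearMap.id ℝ E).ker)ᗮ by
    rw [hd, Submodule.mem_bot, sub_eq_zero] at this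
    rwa [← this] at hS
  rw [← Submodule.iInf_orthogonal, Submodule.mem_iInf]
  intro μ
  rw [Submodule.mem_orthogonal]
  intro u hu
  have hu' : eigenProj T μ u = u := Submodule.starProjection_eq_self_iff.mpr hu
  have h1 : HasSum (fun ν : ℝ => ⟪u, eigenProj T ν v⟫) ⟪u, S⟫ := hS.mapL (innerSL ℝ u)
  have h2 : HasSum (fun ν : ℝ => ⟪u, eigenProj T ν v⟫) ⟪u, eigenProj T μ v⟫ := by
    refine hasSum_single μ fun ν hν => ?_
    rw [← hu']
    exact inner_eigenProj_of_ne hs hν.symm u v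
  have h3 : ⟪u, eigenProj T μ v⟫ = ⟪u, v⟫ := by
    rw [← inner_eigenProj_eq, real_inner_comm, inner_eigenProj_eq, hu', real_inner_comm]
  rw [inner_sub_right, ← h3, h1.unique h2, sub_self]

include hs in
-- Bessel's inequality for the form of T: expand 0 ≤ ⟪T(w - W), w - W⟫ with W a partial sum, using
-- ⟪TW, W⟫ = ⟪TW, w⟫. The eigenvectors need not span.
theorem sum_mul_norm_sq_eigenProj_le (hp : ∀ x, 0 ≤ ⟪T x, x⟫) (w : E) (s : Finset ℝ) :
    ∑ μ ∈ s, μ * ‖eigenProj T μ w‖ ^ 2 ≤ ⟪T w, w⟫ := by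
  set W := ∑ μ ∈ s, eigenProj T μ w with hW
  have hTW : T W = ∑ μ ∈ s, μ • eigenProj T μ w := by
    rw [hW, map_sum]
    exact Finset.sum_congr rfl fun μ _ => map_eigenProj T μ w
  have h1 : ⟪T W, w⟫ = ∑ μ ∈ s, μ * ‖eigenProj T μ w‖ ^ 2 := by
    rw [hTW, sum_inner]
    refine Finset.sum_congr rfl fun μ _ => ?_
    rw [real_inner_smul_left, real_inner_comm, inner_eigenProj_self]
  have h2 : ⟪T W, W⟫ = ∑ μ ∈ s, μ * ‖eigenProj T μ w‖ ^ 2 := by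
    rw [hTW, sum_inner]
    refine Finset.sum_congr rfl fun μ hμ => ?_
    rw [real_inner_smul_left, hW, inner_sum, Finset.sum_eq_single μ
      (fun ν _ hν => inner_eigenProj_of_ne hs hν.symm w w) (fun h => absurd hμ h),
      real_inner_self_eq_norm_sq]
  have h3 := hp (w - W)
  have h4 : ⟪T w, W⟫ = ⟪T W, w⟫ := by rw [hs, real_inner_comm]
  simp only [map_sub, inner_sub_left, inner_sub_right] at h3
  linarith

include hs in
/-- `⟪v, w⟫ = ⟪T^(-1/2) v, T^(1/2) w⟫ ≤ ‖T^(-1/2) v‖ ‖T^(1/2) w‖`. -/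
theorem inner_le_norm_spectralPow_mul {c : ℝ} (hc0 : 0 < c) (hc : ∀ x, c * ‖x‖ ^ 2 ≤ ⟪T x, x⟫)
    (hd : (⨆ μ : ℝ, (T - μ • ContinuousLinearMap.id ℝ E).ker)ᗮ = ⊥) (v w : E) :
    ⟪v, w⟫ ≤ ‖spectralPow T (-1 / 2) v‖ * √⟪T w, w⟫ := by
  have hp : ∀ x, 0 ≤ ⟪T x, x⟫ := fun x => (by positivity : 0 ≤ c * ‖x‖ ^ 2).trans (hc x)
  have horth : ∀ (f : ℝ → ℝ) (u : E) (μ ν : ℝ), μ ≠ ν →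
      ⟪f μ • eigenProj T μ u, f ν • eigenProj T ν u⟫ = 0 := by
    intro f u μ ν h
    rw [real_inner_smul_left, real_inner_smul_right, inner_eigenProj_of_ne hs h, mul_zero, mul_zero]
  -- Without summability the `tsum` in `spectralPow` would default to 0. Here the coefficients are
  -- at most c^(-1/2).
  have hsum : Summable fun μ : ℝ => μ ^ (-1 / 2 : ℝ) • eigenProj T μ v := by
    refine summable_of_pairwise_orthogonal (horth (fun μ => μ ^ (-1 / 2 : ℝ)) v) ?_
    refine Summable.of_nonneg_of_le (fun _ => sq_nonneg _) (fun μ => ?_)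
      ((summable_norm_sq_eigenProj hs v).mul_left ((c ^ (-1 / 2 : ℝ)) ^ 2))
    rw [norm_smul, mul_pow, Real.norm_eq_abs, sq_abs]
    rcases eigenProj_eq_zero_or_le hc μ v with h | h
    · rw [h]; simp
    · refine mul_le_mul_of_nonneg_right ?_ (sq_nonneg _)
      refine pow_le_pow_left₀ (Real.rpow_nonneg (hc0.le.trans h) _) ?_ 2
      exact Real.rpow_le_rpow_of_nonpos hc0 h (by norm_num)
  set z := spectralPow T (-1 / 2) v with hz
  have hzs : HasSum (fun μ : ℝ => μ ^ (-1 / 2 : ℝ) • eigenProj T μ v) z := hsum.hasSum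
  -- Only the μ-component of z survives, and there μ^(-1/2) μ^(1/2) = 1.
  have hzμ : ∀ μ : ℝ, ⟪z, μ ^ (1 / 2 : ℝ) • eigenProj T μ w⟫ = ⟪eigenProj T μ v, w⟫ := by
    intro μ
    have h1 : HasSum (fun ν : ℝ => ⟪eigenProj T μ w, ν ^ (-1 / 2 : ℝ) • eigenProj T ν v⟫)
      ⟪eigenProj T μ w, z⟫ := hzs.mapL (innerSL ℝ (eigenProj T μ w))
    have h2 := hasSum_single (f := fun ν : ℝ =>
        ⟪eigenProj T μ w, ν ^ (-1 / 2 : ℝ) • eigenProj T ν v⟫) μ fun ν hν => by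
      rw [real_inner_smul_right, inner_eigenProj_of_ne hs hν.symm, mul_zero]
    rw [real_inner_smul_right, real_inner_comm, h1.unique h2, real_inner_smul_right,
      inner_eigenProj_eq, ← mul_assoc, real_inner_comm w]
    rcases eigenProj_eq_zero_or_le hc μ v with h | h
    · rw [h]; simp
    · rw [← Real.rpow_add (hc0.trans_le h)]
      norm_num
  have hfin : ∀ s : Finset ℝ, ∑ μ ∈ s, ⟪eigenProj T μ v, w⟫ ≤ ‖z‖ * √⟪T w, w⟫ := by
    intro s
    rw [Finset.sum_congr rfl fun μ _ => (hzμ μ).symm, ← inner_sum]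
    refine (real_inner_le_norm _ _).trans (mul_le_mul_of_nonneg_left ?_ (norm_nonneg _))
    refine Real.le_sqrt_of_sq_le ?_
    rw [norm_sum_sq_of_pairwise_orthogonal (horth (fun μ => μ ^ (1 / 2 : ℝ)) w)]
    refine le_trans (le_of_eq ?_) (sum_mul_norm_sq_eigenProj_le hs hp w s)
    refine Finset.sum_congr rfl fun μ _ => ?_
    rw [norm_smul, mul_pow, Real.norm_eq_abs, sq_abs]
    rcases eigenProj_eq_zero_or_le hc μ w with h | h
    · rw [h]; simp
    · rw [← Real.sqrt_eq_rpow, Real.sq_sqrt (hc0.le.trans h)]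
  have hv : HasSum (fun μ : ℝ => ⟪eigenProj T μ v, w⟫) ⟪v, w⟫ := by
    have := (hasSum_eigenProj hs hd v).mapL (innerSL ℝ w)
    simpa only [innerSL_apply_apply, real_inner_comm w] using this
  exact hasSum_le_of_sum_le hv hfin

end Eigenprojections

/-! ### The source condition -/

section Source

variable {E F : Type*} [NormedAddCommGroup E] [InnerProductSpace ℝ E] [CompleteSpace E]
  [NormedAddCommGroup F] [InnerProductSpace ℝ F] [CompleteSpace F]

/-- The range of `(J J*)^r` with `1/2 ≤ r ≤ 1` consists of images under `J` of vectors `g`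
orthogonal to the kernel of `J`, whose inner products satisfy an interpolation inequality. -/
theorem exists_preimage_spectralPow (J : E →L[ℝ] F) (J' : F →L[ℝ] E)
    (hJ : ∀ f u, ⟪J f, u⟫ = ⟪f, J' u⟫) {r : ℝ} (hr : 1 / 2 ≤ r) (hr' : r ≤ 1) (h : F) :
    ∃ g : E, J g = spectralPow (J.comp J') r h ∧ (∀ k, J k = 0 → ⟪g, k⟫ = 0) ∧
      ∀ w, ⟪g, w⟫ ≤ ‖h‖ * (‖J w‖ ^ (2 * r - 1) * ‖w‖ ^ (2 - 2 * r)) := by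
  set T := J.comp J' with hT
  have hTa : ∀ u, T u = J (J' u) := fun u => rfl
  have hTi : ∀ u v, ⟪T u, v⟫ = ⟪J' u, J' v⟫ := fun u v => by rw [hTa, hJ]
  have hs : ∀ x y, ⟪T x, y⟫ = ⟪x, T y⟫ := fun x y => by
    rw [hTi, real_inner_comm, ← hTi, real_inner_comm]
  have hp : ∀ x, 0 * ‖x‖ ^ 2 ≤ ⟪T x, x⟫ := fun x => by
    rw [hTi, zero_mul]; exact real_inner_self_nonneg
  have hJP : ∀ (μ : ℝ) (u : F), ‖J' (eigenProj T μ u)‖ ^ 2 = μ * ‖eigenProj T μ u‖ ^ 2 := by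
    intro μ u
    rw [← real_inner_self_eq_norm_sq, ← hTi, map_eigenProj, real_inner_smul_left,
      real_inner_self_eq_norm_sq]
  have hzero : ∀ (μ : ℝ) (u : F), μ ≤ 0 → J' (eigenProj T μ u) = 0 := by
    intro μ u hμ
    rw [← norm_eq_zero, ← sq_eq_zero_iff, hJP]
    rcases eigenProj_eq_zero_or_le hp μ u with h0 | h0
    · rw [h0]; simp
    · rw [le_antisymm hμ h0, zero_mul]
  have hJorth : ∀ (f : ℝ → ℝ) (u : F) (μ ν : ℝ), μ ≠ ν →
      ⟪f μ • J' (eigenProj T μ u), f ν • J' (eigenProj T ν u)⟫ = 0 := by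
    intro f u μ ν hne
    rw [real_inner_smul_left, real_inner_smul_right, ← hTi, map_eigenProj, real_inner_smul_left,
      inner_eigenProj_of_ne hs hne, mul_zero, mul_zero, mul_zero]
  -- The preimage is g = ∑ μ^(r-1) J' P_μ h. The negative exponent is harmless: ‖J' P_μ h‖² = μ‖P_μ
  -- h‖² leaves μ^(2r-1) ≤ ‖T‖^(2r-1), as r ≥ 1/2.
  have hsum : Summable fun μ : ℝ => μ ^ (r - 1) • J' (eigenProj T μ h) := by
    refine summable_of_pairwise_orthogonal (hJorth (fun μ => μ ^ (r - 1)) h) ?_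
    refine Summable.of_nonneg_of_le (fun _ => sq_nonneg _) (fun μ => ?_)
      ((summable_norm_sq_eigenProj hs h).mul_left (‖T‖ ^ (2 * r - 1)))
    rcases le_or_gt μ 0 with hμ | hμ
    · rw [hzero μ h hμ, smul_zero, norm_zero, zero_pow two_ne_zero]
      positivity
    · rw [norm_smul, mul_pow, hJP, Real.norm_eq_abs, sq_abs, ← mul_assoc]
      by_cases h0 : eigenProj T μ h = 0
      · rw [h0]; simp
      refine mul_le_mul_of_nonneg_right ?_ (sq_nonneg _)
      have h1 : μ ≤ ‖T‖ := by
        have := T.le_opNorm (eigenProj T μ h)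
        rw [map_eigenProj, norm_smul, Real.norm_of_nonneg hμ.le] at this
        exact le_of_mul_le_mul_right this (norm_pos_iff.mpr h0)
      have h2 : (μ ^ (r - 1)) ^ 2 * μ = μ ^ (2 * r - 1) := by
        rw [← Real.rpow_natCast, ← Real.rpow_mul hμ.le, ← Real.rpow_add_one hμ.ne']
        congr 1; push_cast; ring
      rw [h2]
      exact Real.rpow_le_rpow hμ.le h1 (by linarith)
  obtain ⟨g, hg⟩ := hsum
  have hgi : ∀ w, HasSum (fun μ : ℝ => μ ^ (r - 1) * ⟪eigenProj T μ h, J w⟫) ⟪g, w⟫ := by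
    intro w
    have h1 := hg.mapL (innerSL ℝ w)
    rw [innerSL_apply_apply, real_inner_comm] at h1
    refine h1.congr_fun fun μ => ?_
    rw [innerSL_apply_apply, real_inner_smul_right, ← hJ, real_inner_comm]
  refine ⟨g, ?_, fun k hk => ?_, fun w => ?_⟩
  · have h1 := hg.mapL J
    refine h1.tsum_eq.symm.trans (tsum_congr fun μ => ?_)
    rw [map_smul, ← hTa]
    -- P_0 h may be nonzero, but 0^r = 0 since r > 0, so both terms vanish.
    rcases le_or_gt μ 0 with hμ | hμ
    · rw [hTa, hzero μ h hμ, map_zero, smul_zero]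
      rcases eigenProj_eq_zero_or_le hp μ h with h0 | h0
      · exact (smul_eq_zero_of_right _ h0).symm
      · rw [le_antisymm hμ h0, Real.zero_rpow (by linarith), zero_smul]
    · rw [map_eigenProj, smul_smul, ← Real.rpow_add_one hμ.ne']
      congr 2; ring
  · refine (hgi k).unique ?_
    simp [hk, hasSum_zero]
  · refine hasSum_le_of_sum_le (hgi w) fun s => ?_
    -- For μ > 0, μ⁻¹ J' P_μ J w is the component of w in the μ-eigenspace of J'J. So a sums to at
    -- most ‖Jw‖² and b to at most ‖w‖², and a = μ b gives μ^(2r-2) a = a^(2r-1) b^(2-2r).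
    -- Cauchy–Schwarz and then Hölder with exponents 2r - 1 and 2 - 2r finish.
    set p : ℝ → F := fun μ => eigenProj T μ (J w) with hpdef
    set a : ℝ → ℝ := fun μ => ‖p μ‖ ^ 2 with ha
    set b : ℝ → ℝ := fun μ => ‖μ⁻¹ • J' (p μ)‖ ^ 2 with hb
    have hbμ : ∀ μ : ℝ, 0 < μ → b μ = μ⁻¹ * a μ := by
      intro μ hμ
      simp only [hb, ha, hpdef]
      rw [norm_smul, mul_pow, hJP, Real.norm_eq_abs, sq_abs]
      field_simp
    have hasum : ∑ μ ∈ s, a μ ≤ ‖J w‖ ^ 2 :=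
      sum_norm_sq_le_of_inner_eq (fun _ _ h => inner_eigenProj_of_ne hs h _ _)
        (fun μ => inner_eigenProj_self T μ (J w)) s
    have hbsum : ∑ μ ∈ s, b μ ≤ ‖w‖ ^ 2 := by
      refine sum_norm_sq_le_of_inner_eq (hJorth (fun μ => μ⁻¹) (J w)) (fun μ => ?_) s
      rcases le_or_gt μ 0 with hμ | hμ
      · rw [hzero μ _ hμ]; simp
      · have h1 := hbμ μ hμ
        simp only [hb, ha, hpdef] at h1
        rw [h1, real_inner_smul_right, ← hJ, inner_eigenProj_self]
    have hterm : ∀ μ : ℝ, μ ^ (r - 1) * ⟪eigenProj T μ h, J w⟫ ≤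
        ‖eigenProj T μ h‖ * √(a μ ^ (2 * r - 1) * b μ ^ (2 - 2 * r)) := by
      intro μ
      rcases le_or_gt μ 0 with hμ | hμ
      · rw [real_inner_comm, hJ, hzero μ h hμ, inner_zero_right, mul_zero]
        positivity
      · have h1 : ⟪eigenProj T μ h, J w⟫ ≤ ‖eigenProj T μ h‖ * ‖p μ‖ := by
          rw [real_inner_comm, ← inner_eigenProj_eq, real_inner_comm]
          exact real_inner_le_norm _ _
        have ha0 : 0 ≤ a μ := sq_nonneg _
        have h2 : a μ ^ (2 * r - 1) * b μ ^ (2 - 2 * r) = (μ ^ (r - 1) * ‖p μ‖) ^ 2 := by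
          rw [hbμ μ hμ, Real.mul_rpow (inv_nonneg.mpr hμ.le) ha0, mul_left_comm,
            ← Real.rpow_add' ha0 (by norm_num), mul_pow, Real.inv_rpow hμ.le,
            ← Real.rpow_neg hμ.le, ← Real.rpow_natCast (μ ^ (r - 1)), ← Real.rpow_mul hμ.le]
          congr 1
          · congr 1; push_cast; ring
          · rw [show 2 * r - 1 + (2 - 2 * r) = (1 : ℝ) by ring, Real.rpow_one]
        rw [h2, Real.sqrt_sq (by positivity)]
        calc _ ≤ μ ^ (r - 1) * (‖eigenProj T μ h‖ * ‖p μ‖) := by gcongr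
          _ = _ := by ring
    calc ∑ μ ∈ s, μ ^ (r - 1) * ⟪eigenProj T μ h, J w⟫
        ≤ ∑ μ ∈ s, ‖eigenProj T μ h‖ * √(a μ ^ (2 * r - 1) * b μ ^ (2 - 2 * r)) :=
          Finset.sum_le_sum fun μ _ => hterm μ
      _ ≤ √(∑ μ ∈ s, ‖eigenProj T μ h‖ ^ 2) *
          √(∑ μ ∈ s, √(a μ ^ (2 * r - 1) * b μ ^ (2 - 2 * r)) ^ 2) :=
        Real.sum_mul_le_sqrt_mul_sqrt _ _ _
      _ ≤ ‖h‖ * (‖J w‖ ^ (2 * r - 1) * ‖w‖ ^ (2 - 2 * r)) := by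
        refine mul_le_mul ?_ ?_ (Real.sqrt_nonneg _) (norm_nonneg _)
        · refine Real.sqrt_le_iff.mpr ⟨norm_nonneg _, ?_⟩
          exact sum_norm_sq_le_of_inner_eq (fun _ _ h' => inner_eigenProj_of_ne hs h' _ _)
            (fun μ => inner_eigenProj_self T μ h) s
        · refine Real.sqrt_le_iff.mpr ⟨by positivity, ?_⟩
          have hpow : ∀ (x e : ℝ), 0 ≤ x → (x ^ e) ^ 2 = (x ^ 2) ^ e := by
            intro x e hx
            rw [← Real.rpow_natCast, ← Real.rpow_mul hx, mul_comm, Real.rpow_mul hx,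
              Real.rpow_natCast]
          have hb0 : ∀ μ, 0 ≤ b μ := fun μ => sq_nonneg _
          have ha0 : ∀ μ, 0 ≤ a μ := fun μ => sq_nonneg _
          rw [mul_pow, hpow _ _ (norm_nonneg _), hpow _ _ (norm_nonneg _),
            Finset.sum_congr rfl fun μ _ => Real.sq_sqrt (mul_nonneg
              (Real.rpow_nonneg (ha0 μ) _) (Real.rpow_nonneg (hb0 μ) _))]
          refine (sum_rpow_mul_rpow_le s ha0 hb0 (by linarith) (by linarith) (by ring)).trans ?_
          exact mul_le_mul
            (Real.rpow_le_rpow (Finset.sum_nonneg fun μ _ => ha0 μ) hasum (by linarith))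
            (Real.rpow_le_rpow (Finset.sum_nonneg fun μ _ => hb0 μ) hbsum (by linarith))
            (Real.rpow_nonneg (Finset.sum_nonneg fun μ _ => hb0 μ) _)
            (by positivity)

end Source

/-! ### The integral operator -/

section IntegralOperatorLemmas

variable {X : Type*} [TopologicalSpace X] [CompactSpace X] [SecondCountableTopology X]
  [MeasurableSpace X] [OpensMeasurableSpace X]
  {H : Type*} [NormedAddCommGroup H] [InnerProductSpace ℝ H] [RKHS ℝ H X ℝ] [CompleteSpace H]
  {K : X → X → ℝ}

theorem IsRKHSOf.coeFn_incl (hH : IsRKHSOf K H) (ν : Measure X) [IsFiniteMeasure ν] (f : H) :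
    (hH.incl ν f : X → ℝ) =ᵐ[ν] f :=
  (hH.memLp_coe ν f).coeFn_toLp

/-- The reproducing property under the integral sign. This adjointness is the input of
`exists_preimage_spectralPow`. -/
theorem IsRKHSOf.inner_incl (hH : IsRKHSOf K H) (ν : Measure X) [IsFiniteMeasure ν] (f : H)
    (g : Lp ℝ 2 ν) : ⟪hH.incl ν f, g⟫ = ⟪f, hH.integralMap ν g⟫ := by
  change _ = ⟪f, ∫ x, g x • kerSec H x ∂ν⟫
  rw [← integral_inner (hH.integrable_smul ν g) f, L2.inner_def]
  refine integral_congr_ae ?_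
  filter_upwards [hH.coeFn_incl ν f] with x hx
  rw [hx, real_inner_smul_right, real_inner_comm (kerSec H x) f, inner_kerSec]
  simp

theorem IsRKHSOf.inner_LK (hH : IsRKHSOf K H) (ν : Measure X) [IsFiniteMeasure ν] (f g : H) :
    ⟪hH.LK ν f, g⟫ = ⟪hH.incl ν f, hH.incl ν g⟫ := by
  rw [real_inner_comm]
  change ⟪g, hH.integralMap ν (hH.incl ν f)⟫ = _
  rw [← hH.inner_incl, real_inner_comm]

theorem IsRKHSOf.incl_eq_zero_iff (hH : IsRKHSOf K H) (ν : Measure X) [IsFiniteMeasure ν] (f : H) :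
    hH.incl ν f = 0 ↔ (f : X → ℝ) =ᵐ[ν] 0 := by
  rw [Lp.eq_zero_iff_ae_eq_zero]
  exact ⟨fun h => (hH.coeFn_incl ν f).symm.trans h, fun h => (hH.coeFn_incl ν f).trans h⟩

/-- L_K is the Bochner integral of the rank-one operators f ↦ f(x) K_x, and the compact operators
form a closed convex set. -/
theorem IsRKHSOf.isCompactOperator_LK (hH : IsRKHSOf K H) (ν : Measure X)
    [IsProbabilityMeasure ν] : IsCompactOperator (hH.LK ν) := by
  let R : X → H →L[ℝ] H := fun x => (innerSL ℝ (kerSec H x)).smulRight (kerSec H x)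
  have hRc : Continuous R := by
    have : R = fun x => ContinuousLinearMap.smulRightL ℝ H H (innerSL ℝ (kerSec H x))
      (kerSec H x) := rfl
    rw [this]
    have hk := hH.continuous_kerSec
    have h1 : Continuous fun x => innerSL ℝ (kerSec H x) := (innerSL ℝ).continuous.comp hk
    fun_prop
  have hRi : Integrable R ν := by
    obtain ⟨C, hC⟩ := (isCompact_range hRc).isBounded.exists_norm_le
    exact memLp_one_iff_integrable.mp (MemLp.of_bound hRc.aestronglyMeasurable C
      (Filter.Eventually.of_forall fun x => hC _ (Set.mem_range_self x)))
  have hLK : hH.LK ν = ∫ x, R x ∂ν := by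
    ext1 f
    rw [ContinuousLinearMap.integral_apply hRi]
    change ∫ x, (hH.incl ν f) x • kerSec H x ∂ν = _
    refine integral_congr_ae ?_
    filter_upwards [hH.coeFn_incl ν f] with x hx
    rw [hx]
    change _ = ⟪kerSec H x, f⟫ • kerSec H x
    rw [inner_kerSec]
  rw [hLK]
  refine Convex.integral_mem (s := {T : H →L[ℝ] H | IsCompactOperator T})
    (compactOperator (RingHom.id ℝ) H H).convex isClosed_setOfPred_isCompactOperator
    (Filter.Eventually.of_forall fun x => ?_) hRi
  have h1 : IsCompactOperator (innerSL ℝ (kerSec H x)) :=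
    isCompactOperator_of_locallyCompactSpace_dom _
  exact h1.clm_comp (ContinuousLinearMap.toSpanSingleton ℝ (kerSec H x))

/-- The spectral theorem for the compact self-adjoint L_K; adding λ I shifts the eigenvalues and
keeps the eigenspaces. -/
theorem IsRKHSOf.iSup_ker_LK_add_orthogonal (hH : IsRKHSOf K H) (ν : Measure X)
    [IsProbabilityMeasure ν] (lam : ℝ) :
    (⨆ μ : ℝ, ((hH.LK ν + lam • 1) - μ • ContinuousLinearMap.id ℝ H).ker)ᗮ = ⊥ := by
  have hsym : (hH.LK ν).IsSymmetric := fun f g => by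
    change ⟪hH.LK ν f, g⟫ = ⟪f, hH.LK ν g⟫
    rw [hH.inner_LK, real_inner_comm _ f, hH.inner_LK, real_inner_comm]
  rw [eq_bot_iff, ← ContinuousLinearMap.orthogonalComplement_iSup_eigenspaces_eq_bot
    (hH.isCompactOperator_LK ν) hsym]
  refine Submodule.orthogonal_le (iSup_le fun μ => ?_)
  refine le_trans ?_ (le_iSup _ (μ + lam))
  intro v hv
  rw [Module.End.mem_eigenspace_iff] at hv
  rw [mem_ker_sub_smul_id, add_smul]
  exact congrArg (· + lam • v) hv

end IntegralOperatorLemmas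

/-! ### The sampling operators -/

section SamplingLemmas

variable {X : Type*} {H : Type*} [NormedAddCommGroup H] [InnerProductSpace ℝ H]
  [RKHS ℝ H X ℝ] [CompleteSpace H] {n : ℕ}

theorem inner_samplingAdj (D : Fin n → X × ℝ) (c : Fin n → ℝ) (g : H) :
    ⟪samplingAdj H D c, g⟫ = 1 / (n : ℝ) * ∑ i, c i * g (D i).1 := by
  have : samplingAdj H D c = (1 / (n : ℝ)) • ∑ i, c i • kerSec H (D i).1 := by
    simp [samplingAdj]
  rw [this, real_inner_smul_left, sum_inner]
  congr 1
  refine Finset.sum_congr rfl fun i _ => ?_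
  rw [real_inner_smul_left, inner_kerSec]

theorem inner_LKD (D : Fin n → X × ℝ) (f g : H) :
    ⟪LKD H D f, g⟫ = 1 / (n : ℝ) * ∑ i, f (D i).1 * g (D i).1 :=
  inner_samplingAdj D _ g

/-- The Euler equation of the Nyström estimator. -/
theorem IsNystrom.inner_eq_zero {m : ℕ} {D : Fin n → X × ℝ} {D' : Fin m → X × ℝ} {lam : ℝ} {f : H}
    (hf : IsNystrom D D' lam f) {v : H} (hv : v ∈ hypSpace H D') :
    ⟪LKD H D f + lam • f - samplingAdj H D (outputs D), v⟫ = 0 := by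
  set a := ⟪LKD H D f + lam • f - samplingAdj H D (outputs D), v⟫ with ha
  -- Along the line f + t v the risk is quadratic in t with slope 2a at 0. Minimality makes the
  -- increment nonnegative, and its discriminant then forces a = 0.
  have hexp : ∀ t : ℝ, regRisk D lam (f + t • v) =
      regRisk D lam f + 2 * a * t + (⟪LKD H D v, v⟫ + lam * ‖v‖ ^ 2) * (t * t) := by
    intro t
    have h1 : ∀ i, ((f + t • v) (D i).1 - (D i).2) ^ 2 = (f (D i).1 - (D i).2) ^ 2
        + 2 * t * (f (D i).1 * v (D i).1 - outputs D i * v (D i).1)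
        + t * t * (v (D i).1 * v (D i).1) := by
      intro i
      rw [RKHS.coe_add, Pi.add_apply, RKHS.coe_smul, Pi.smul_apply, smul_eq_mul, outputs]
      ring
    rw [regRisk, regRisk, Finset.sum_congr rfl fun i _ => h1 i, Finset.sum_add_distrib,
      Finset.sum_add_distrib, ← Finset.mul_sum, ← Finset.mul_sum, Finset.sum_sub_distrib,
      norm_add_sq_real, norm_smul, real_inner_smul_right, mul_pow, Real.norm_eq_abs, sq_abs, ha,
      inner_sub_left, inner_add_left, inner_LKD, inner_LKD, inner_samplingAdj,
      real_inner_smul_left]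
    ring
  have hq : ∀ t : ℝ, 0 ≤ (⟪LKD H D v, v⟫ + lam * ‖v‖ ^ 2) * (t * t) + 2 * a * t + 0 := by
    intro t
    have := hf.2 _ (Submodule.add_mem _ hf.1 (Submodule.smul_mem _ t hv))
    rw [hexp] at this
    linarith
  have h2 := discrim_le_zero hq
  rw [discrim] at h2
  have h3 : a ^ 2 = 0 := le_antisymm (by nlinarith) (sq_nonneg a)
  exact pow_eq_zero_iff two_ne_zero |>.mp h3

end SamplingLemmas

/-! ### The quadratic form of the regularized empirical operator -/

section RegularizedSampling

variable {X : Type*} {H : Type*} [NormedAddCommGroup H] [InnerProductSpace ℝ H]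
  [RKHS ℝ H X ℝ] [CompleteSpace H] {n : ℕ} (D : Fin n → X × ℝ) (lam : ℝ)

theorem inner_LKD_add (x y : H) : ⟪(LKD H D + lam • 1) x, y⟫ =
    1 / (n : ℝ) * ∑ i, x (D i).1 * y (D i).1 + lam * ⟪x, y⟫ := by
  change ⟪LKD H D x + lam • x, y⟫ = _
  rw [inner_add_left, inner_LKD, real_inner_smul_left]

theorem inner_LKD_add_comm (x y : H) :
    ⟪(LKD H D + lam • 1) x, y⟫ = ⟪x, (LKD H D + lam • 1) y⟫ := by
  rw [real_inner_comm _ x, inner_LKD_add, inner_LKD_add, real_inner_comm]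
  simp only [mul_comm (x _)]

theorem le_inner_LKD_add (x : H) : lam * ‖x‖ ^ 2 ≤ ⟪(LKD H D + lam • 1) x, x⟫ := by
  rw [inner_LKD_add, real_inner_self_eq_norm_sq]
  exact le_add_of_nonneg_left
    (mul_nonneg (by positivity) (Finset.sum_nonneg fun i _ => mul_self_nonneg _))

/-- By the reproducing property x vanishes at the sample points, so only the regularization term
remains. -/
theorem inner_LKD_add_of_mem_orthogonal {x : H} (hx : x ∈ (hypSpace H D)ᗮ) :
    ⟪(LKD H D + lam • 1) x, x⟫ = lam * ‖x‖ ^ 2 := by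
  have h0 : ∀ i, x (D i).1 = 0 := fun i => by
    rw [← inner_kerSec]
    exact (Submodule.mem_orthogonal _ _).mp hx _ (Submodule.subset_span ⟨i, rfl⟩)
  rw [inner_LKD_add, real_inner_self_eq_norm_sq]
  simp [h0]

end RegularizedSampling

/-! ### The error bound -/

section ErrorBound

/-- Evaluates the source inequality, with x = ‖Jw‖, y = ‖w‖ and b a regularized norm of w. It serves
once for v (κ = Q_{D_m}, b = √λ ‖v‖) and once for e (κ = Q_D, b the B-norm). -/
theorem rpow_mul_rpow_le_of_le_sqrt_mul {r lam κ b x y : ℝ} (hr : 1 / 2 ≤ r) (hr' : r ≤ 1)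
    (hlam : 0 < lam) (hκ : 0 ≤ κ) (hb : 0 ≤ b) (hx0 : 0 ≤ x) (hy0 : 0 ≤ y)
    (hx : x ≤ √κ * b) (hy : √lam * y ≤ b) :
    x ^ (2 * r - 1) * y ^ (2 - 2 * r) ≤ κ ^ (r - 1 / 2) * lam ^ (r - 1) * b := by
  have hy' : y ≤ lam ^ (-1 / 2 : ℝ) * b := by
    have h1 : lam ^ (-1 / 2 : ℝ) * √lam = 1 := by
      rw [Real.sqrt_eq_rpow, ← Real.rpow_add hlam]
      norm_num
    calc y = lam ^ (-1 / 2 : ℝ) * (√lam * y) := by rw [← mul_assoc, h1, one_mul]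
      _ ≤ _ := mul_le_mul_of_nonneg_left hy (Real.rpow_nonneg hlam.le _)
  calc x ^ (2 * r - 1) * y ^ (2 - 2 * r)
      ≤ (√κ * b) ^ (2 * r - 1) * (lam ^ (-1 / 2 : ℝ) * b) ^ (2 - 2 * r) :=
        mul_le_mul (Real.rpow_le_rpow hx0 hx (by linarith))
          (Real.rpow_le_rpow hy0 hy' (by linarith)) (Real.rpow_nonneg hy0 _) (by positivity)
    _ = κ ^ (r - 1 / 2) * lam ^ (r - 1) * (b ^ (2 * r - 1) * b ^ (2 - 2 * r)) := by
        rw [Real.mul_rpow (Real.sqrt_nonneg _) hb, Real.mul_rpow (Real.rpow_nonneg hlam.le _) hb,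
          Real.sqrt_eq_rpow, ← Real.rpow_mul hκ, ← Real.rpow_mul hlam.le,
          show 1 / 2 * (2 * r - 1) = r - 1 / 2 by ring,
          show -1 / 2 * (2 - 2 * r) = r - 1 by ring]
        ring
    _ = κ ^ (r - 1 / 2) * lam ^ (r - 1) * b := by
        rw [← Real.rpow_add' hb (by norm_num), show 2 * r - 1 + (2 - 2 * r) = (1 : ℝ) by ring,
          Real.rpow_one]

theorem sqrt_mul_rpow_sub_half {r x : ℝ} (hr : 1 / 2 ≤ r) (hx : 0 ≤ x) :
    √x * x ^ (r - 1 / 2) = x ^ r := by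
  rw [Real.sqrt_eq_rpow, ← Real.rpow_add' hx (by linarith)]
  congr 1; ring

variable {E F : Type*} [NormedAddCommGroup E] [InnerProductSpace ℝ E]
  [NormedAddCommGroup F] [InnerProductSpace ℝ F]

/-- Error bound for a Galerkin solution `f ∈ V` of `B f = B g - lam g + q`, where `g` satisfies a
source condition of order `r` with constant `N`. -/
theorem norm_map_sub_le_of_galerkin (J : E →L[ℝ] F) {A B C : E →L[ℝ] E} {V : Submodule ℝ E}
    [V.HasOrthogonalProjection] {lam r N P Q Qs Qm : ℝ} {f g q : E}
    (hlam : 0 < lam) (hr : 1 / 2 ≤ r) (hr' : r ≤ 1) (hN : 0 ≤ N) (hP0 : 0 ≤ P)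
    (hQ0 : 0 ≤ Q) (hQs0 : 0 ≤ Qs) (hQm0 : 0 ≤ Qm)
    (hBs : ∀ x y, ⟪B x, y⟫ = ⟪x, B y⟫) (hB : ∀ x, lam * ‖x‖ ^ 2 ≤ ⟪B x, x⟫)
    (hJA : ∀ x, ‖J x‖ ^ 2 ≤ ⟪A x, x⟫) (hAB : ∀ x, ⟪A x, x⟫ ≤ Q * ⟪B x, x⟫)
    (hBA : ∀ x, ⟪B x, x⟫ ≤ Qs * ⟪A x, x⟫) (hAC : ∀ x, ⟪A x, x⟫ ≤ Qm * ⟪C x, x⟫)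
    (hCV : ∀ x ∈ Vᗮ, ⟪C x, x⟫ = lam * ‖x‖ ^ 2)
    (hg : ∀ w, ⟪g, w⟫ ≤ N * (‖J w‖ ^ (2 * r - 1) * ‖w‖ ^ (2 - 2 * r)))
    (hq : ∀ w, ⟪q, w⟫ ≤ P * √⟪A w, w⟫) (hf : f ∈ V)
    (hfV : ∀ w ∈ V, ⟪B f, w⟫ = ⟪B g - lam • g + q, w⟫) :
    ‖J (f - g)‖ ≤ Q * P + lam ^ r * Q ^ r * N +
      (Q ^ (1 / 2 : ℝ) * Qs ^ (1 / 2 : ℝ) + 1) * lam ^ r * Qm ^ r * N := by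
  rw [← Real.sqrt_eq_rpow, ← Real.sqrt_eq_rpow]
  have hB0 : ∀ x, 0 ≤ ⟪B x, x⟫ := fun x => (by positivity : 0 ≤ lam * ‖x‖ ^ 2).trans (hB x)
  have hJA' : ∀ x, ‖J x‖ ≤ √⟪A x, x⟫ := fun x => Real.le_sqrt_of_sq_le (hJA x)
  have hAB' : ∀ x, √⟪A x, x⟫ ≤ √Q * √⟪B x, x⟫ := fun x => by
    rw [← Real.sqrt_mul hQ0]; exact Real.sqrt_le_sqrt (hAB x)
  have hBn : ∀ x, √lam * ‖x‖ ≤ √⟪B x, x⟫ := fun x => by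
    refine Real.le_sqrt_of_sq_le ?_
    rw [mul_pow, Real.sq_sqrt hlam.le]
    exact hB x
  set p := V.starProjection g with hp
  have hpV : p ∈ V := Submodule.starProjection_apply_mem _ _
  set v := g - p with hv
  set e := f - p with he
  have heV : e ∈ V := V.sub_mem hf hpV
  have hvV : v ∈ Vᗮ := V.sub_starProjection_mem_orthogonal g
  set X := √⟪A v, v⟫ with hX
  set b := √⟪B e, e⟫ with hb
  have hb0 : 0 ≤ b := Real.sqrt_nonneg _
  have hXv : X ≤ √Qm * (√lam * ‖v‖) := by
    refine Real.sqrt_le_iff.mpr ⟨by positivity, ?_⟩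
    rw [mul_pow, mul_pow, Real.sq_sqrt hlam.le, Real.sq_sqrt hQm0, ← hCV v hvV]
    exact hAC v
  -- ‖v‖² = ⟪g, v⟫, and the source inequality bounds the right side by a constant times ‖v‖; divide
  -- by ‖v‖.
  have hvn : ‖v‖ ≤ N * (Qm ^ (r - 1 / 2) * lam ^ (r - 1) * √lam) := by
    have h1 : ‖v‖ ^ 2 = ⟪g, v⟫ := by
      have h2 : ⟪p, v⟫ = 0 := (Submodule.mem_orthogonal V v).mp hvV p hpV
      rw [← real_inner_self_eq_norm_sq, hv, inner_sub_left, ← hv, h2, sub_zero]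
    have h3 := rpow_mul_rpow_le_of_le_sqrt_mul hr hr' hlam hQm0 (by positivity) (norm_nonneg _)
      (norm_nonneg _) ((hJA' v).trans hXv) le_rfl
    have h4 := (hg v).trans (mul_le_mul_of_nonneg_left h3 hN)
    rcases (norm_nonneg v).eq_or_lt with h0 | h0
    · rw [← h0]; positivity
    · refine le_of_mul_le_mul_right ?_ h0
      calc ‖v‖ * ‖v‖ = ⟪g, v⟫ := by rw [← h1, sq]
        _ ≤ _ := h4
        _ = _ := by ring
  have hXle : X ≤ lam ^ r * Qm ^ r * N := by
    refine hXv.trans ((mul_le_mul_of_nonneg_left (mul_le_mul_of_nonneg_left hvn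
      (Real.sqrt_nonneg lam)) (Real.sqrt_nonneg Qm)).trans (le_of_eq ?_))
    have h1 : lam ^ r = √lam * √lam * lam ^ (r - 1) := by
      rw [Real.mul_self_sqrt hlam.le, mul_comm, ← Real.rpow_add_one hlam.ne']
      congr 1; ring
    rw [← sqrt_mul_rpow_sub_half hr hQm0, h1]
    ring
  have hge : -(lam * ⟪g, e⟫) ≤ lam ^ r * N * Q ^ (r - 1 / 2) * b := by
    have h3 := rpow_mul_rpow_le_of_le_sqrt_mul hr hr' hlam hQ0 hb0 (norm_nonneg _)
      (norm_nonneg _) ((hJA' e).trans (hAB' e)) (hBn e)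
    have h4 := hg (-e)
    rw [map_neg, norm_neg, norm_neg, inner_neg_right] at h4
    have h5 := mul_le_mul_of_nonneg_left (h4.trans (mul_le_mul_of_nonneg_left h3 hN)) hlam.le
    have h6 : lam ^ r = lam * lam ^ (r - 1) := by
      rw [mul_comm, ← Real.rpow_add_one hlam.ne']
      congr 1; ring
    rw [h6]
    linarith
  have hBv : ⟪B v, e⟫ ≤ √Qs * X * b := by
    refine (le_abs_self _).trans ((abs_inner_map_le hBs hB0 v e).trans ?_)
    refine mul_le_mul_of_nonneg_right ?_ hb0
    rw [hX, ← Real.sqrt_mul hQs0]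
    exact Real.sqrt_le_sqrt (hBA v)
  have hqe : ⟪q, e⟫ ≤ P * √Q * b := by
    refine (hq e).trans ?_
    rw [mul_assoc]
    exact mul_le_mul_of_nonneg_left (hAB' e) hP0
  -- The Galerkin equation tested with e, which lies in V.
  have hbsq : b * b = ⟪B v, e⟫ - lam * ⟪g, e⟫ + ⟪q, e⟫ := by
    have h1 := hfV e heV
    rw [inner_add_left, inner_sub_left, real_inner_smul_left] at h1
    have h2 : ⟪B e, e⟫ = ⟪B f, e⟫ - ⟪B p, e⟫ := by
      conv_lhs => rw [he, map_sub, inner_sub_left]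
    have h3 : ⟪B v, e⟫ = ⟪B g, e⟫ - ⟪B p, e⟫ := by rw [hv, map_sub, inner_sub_left]
    rw [hb, Real.mul_self_sqrt (hB0 e), h2, h3, h1]
    ring
  have hX0 : 0 ≤ X := Real.sqrt_nonneg _
  have hble : b ≤ √Qs * X + lam ^ r * N * Q ^ (r - 1 / 2) + P * √Q := by
    rcases hb0.eq_or_lt with h0 | h0
    · rw [← h0]; positivity
    · refine le_of_mul_le_mul_right ?_ h0
      linarith
  have hfe : f - g = e - v := by rw [he, hv]; abel
  calc ‖J (f - g)‖ ≤ ‖J e‖ + ‖J v‖ := by rw [hfe, map_sub]; exact norm_sub_le _ _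
    _ ≤ √Q * b + X := add_le_add ((hJA' e).trans (hAB' e)) (hJA' v)
    _ ≤ √Q * (√Qs * X + lam ^ r * N * Q ^ (r - 1 / 2) + P * √Q) + X := by gcongr
    _ = √Q * √Q * P + lam ^ r * (√Q * Q ^ (r - 1 / 2)) * N + (√Q * √Qs + 1) * X := by ring
    _ = Q * P + lam ^ r * Q ^ r * N + (√Q * √Qs + 1) * X := by
        rw [Real.mul_self_sqrt hQ0, sqrt_mul_rpow_sub_half hr hQ0]
    _ ≤ Q * P + lam ^ r * Q ^ r * N + (√Q * √Qs + 1) * (lam ^ r * Qm ^ r * N) := by gcongr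
    _ = _ := by ring

end ErrorBound

/-! ### The Nyström error bound -/

theorem proposition1 {d : ℕ} {M : ℝ}
    {K : InputSpace d M → InputSpace d M → ℝ}
    {H : Type*} [NormedAddCommGroup H] [InnerProductSpace ℝ H] [CompleteSpace H]
    [RKHS ℝ H (InputSpace d M) ℝ] (hH : IsRKHSOf K H)
    (ρ : Measure (InputSpace d M × ℝ)) [IsProbabilityMeasure ρ]
    (hρ : ∀ᵐ z ∂ρ, z.2 ∈ Set.Icc (-M) M)
    {n : ℕ} (D : Fin n → InputSpace d M × ℝ) (hD : ∀ t, (D t).2 ∈ Set.Icc (-M) M)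
    {j m : ℕ} (hm : 1 ≤ m) (hjm : j + m ≤ n)
    {lam : ℝ} (hlam : 0 < lam)
    {r : ℝ} (hr : 1 / 2 ≤ r) (hr' : r ≤ 1)
    (h : Lp ℝ 2 ρ.fst)
    (hreg : regressionFunction ρ =ᵐ[ρ.fst]
      (spectralPow (hH.LKL2 ρ.fst) r h : Lp ℝ 2 ρ.fst)) :
    (∃! f : H, IsRepresentative ρ.fst (regressionFunction ρ) f) ∧
    ∀ fρ : H, IsRepresentative ρ.fst (regressionFunction ρ) fρ →
    ∀ f : H, IsNystrom D (seqSubsample D j m hjm) lam f →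
      eLpNorm (fun x => f x - regressionFunction ρ x) 2 ρ.fst ≤ ENNReal.ofReal (
        hH.Q ρ.fst D lam * hH.P ρ.fst D lam fρ
        + lam ^ r * hH.Q ρ.fst D lam ^ r * ‖h‖
        + (hH.Q ρ.fst D lam ^ (1 / 2 : ℝ) * hH.Qstar ρ.fst D lam ^ (1 / 2 : ℝ) + 1)
          * lam ^ r * hH.Q ρ.fst (seqSubsample D j m hjm) lam ^ r * ‖h‖) := by
  obtain ⟨g, hJg, hgk, hgw⟩ :=
    exists_preimage_spectralPow (hH.incl ρ.fst) (hH.integralMap ρ.fst) (hH.inner_incl ρ.fst) hr hr' h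
  have hgrep : IsRepresentative ρ.fst (regressionFunction ρ) g := by
    refine ⟨?_, fun k hk => hgk k ((hH.incl_eq_zero_iff ρ.fst k).mpr hk)⟩
    refine (hH.coeFn_incl ρ.fst g).symm.trans (Filter.EventuallyEq.trans ?_ hreg.symm)
    rw [hJg]
    rfl
  -- The difference of two representatives vanishes almost everywhere, hence is orthogonal to
  -- itself.
  have huniq : ∀ g' : H, IsRepresentative ρ.fst (regressionFunction ρ) g' → g' = g := by
    intro g' hg'
    have h0 : ((g' - g : H) : InputSpace d M → ℝ) =ᵐ[ρ.fst] 0 := by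
      rw [RKHS.coe_sub]
      filter_upwards [hg'.1, hgrep.1] with x h1 h2
      rw [Pi.sub_apply, h1, h2, sub_self, Pi.zero_apply]
    rw [← sub_eq_zero, ← inner_self_eq_zero (𝕜 := ℝ), inner_sub_left, hg'.2 _ h0, hgrep.2 _ h0,
      sub_zero]
  refine ⟨⟨g, hgrep, huniq⟩, fun fρ hfρ f hf => ?_⟩
  obtain rfl := huniq fρ hfρ
  set D' := seqSubsample D j m hjm
  have : FiniteDimensional ℝ (hypSpace H D') := .span_of_finite ℝ (Set.finite_range _)
  have hLKs : ∀ x y, ⟪(hH.LK ρ.fst + lam • 1) x, y⟫ = ⟪hH.incl ρ.fst x, hH.incl ρ.fst y⟫ + lam * ⟪x, y⟫ := by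
    intro x y
    change ⟪hH.LK ρ.fst x + lam • x, y⟫ = _
    rw [inner_add_left, hH.inner_LK, real_inner_smul_left]
  have hAs : ∀ x y, ⟪(hH.LK ρ.fst + lam • 1) x, y⟫ = ⟪x, (hH.LK ρ.fst + lam • 1) y⟫ := by
    intro x y
    rw [real_inner_comm _ x, hLKs, hLKs, real_inner_comm, real_inner_comm x]
  have hA : ∀ x, lam * ‖x‖ ^ 2 ≤ ⟪(hH.LK ρ.fst + lam • 1) x, x⟫ := by
    intro x
    rw [hLKs, real_inner_self_eq_norm_sq x]
    exact le_add_of_nonneg_left real_inner_self_nonneg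
  have hJA : ∀ x, ‖hH.incl ρ.fst x‖ ^ 2 ≤ ⟪(hH.LK ρ.fst + lam • 1) x, x⟫ := by
    intro x
    rw [hLKs, real_inner_self_eq_norm_sq (hH.incl ρ.fst x)]
    exact le_add_of_nonneg_right (mul_nonneg hlam.le real_inner_self_nonneg)
  refine le_trans (le_of_eq ?_) (ENNReal.ofReal_le_ofReal (norm_map_sub_le_of_galerkin (hH.incl ρ.fst)
    (V := hypSpace H D') (A := hH.LK ρ.fst + lam • 1) (B := LKD H D + lam • 1)
    (C := LKD H D' + lam • 1) (q := samplingAdj H D (outputs D) - LKD H D fρ) (f := f) (g := fρ)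
    hlam hr hr' (norm_nonneg h) (norm_nonneg _) (norm_nonneg _) (norm_nonneg _) (norm_nonneg _)
    (inner_LKD_add_comm D lam) (le_inner_LKD_add D lam) hJA
    (inner_map_le_norm_mul_inverse hAs (inner_LKD_add_comm D lam) hlam (le_inner_LKD_add D lam))
    (inner_map_le_norm_inverse_mul hAs (inner_LKD_add_comm D lam) hlam hA)
    (inner_map_le_norm_mul_inverse hAs (inner_LKD_add_comm D' lam) hlam (le_inner_LKD_add D' lam))
    (fun x hx => inner_LKD_add_of_mem_orthogonal D' lam hx) hgw (fun w => ?_) hf.1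
    (fun w hw => ?_)))
  · rw [ofReal_norm, Lp.enorm_def]
    refine eLpNorm_congr_ae ?_
    filter_upwards [hH.coeFn_incl ρ.fst (f - fρ), hfρ.1] with x h1 h2
    rw [h1, RKHS.coe_sub, Pi.sub_apply, h2]
  -- P is formed with L_{K,D} f_ρ - S_Dᵀ y_D = -q, so the duality bound is applied at -w.
  · have := inner_le_norm_spectralPow_mul hAs hlam hA (hH.iSup_ker_LK_add_orthogonal ρ.fst lam)
      (LKD H D fρ - samplingAdj H D (outputs D)) (-w)
    rw [map_neg, inner_neg_neg, inner_neg_right, ← inner_neg_left, neg_sub] at this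
    exact this
  -- B g - λ g + q collapses to S_Dᵀ y_D, so this is the Euler equation.
  · have h1 := hf.inner_eq_zero hw
    rw [← sub_eq_zero, ← inner_sub_left, ← h1]
    congr 1
    change LKD H D f + lam • f - (LKD H D fρ + lam • fρ - lam • fρ +
      (samplingAdj H D (outputs D) - LKD H D fρ)) = _
    abel
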